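/- Let $\mathbb{R}^{2,1}$ be $\mathbb{R}^3$ with the metric $\langle\cdot,\cdot\rangle=-dx_1^2+dx_2^2+dx_3^2$. A vector $v$ is lightlike if $v\neq 0$ and $\langle v,v\rangle=0$, and spacelike if $\langle v,v\rangle>0$. A (smooth, immersed) surface $M$ in $\mathbb{R}^{2,1}$ is timelike if the induced metric has signature $(1,1)$. It has a canonical null direction with respect to a constant vector $Z\in\mathbb{R}^{2,1}$ if the tangent part $Z^{\top}$ of $Z$ is lightlike at every point of $M$. **Theorem.** (1) Let $M$ be a timelike surface in $\mathbb{R}^{2,1}$ with a canonical null direction with respect to some constant vector $Z$. Then near every point, taken as the image of $(0,0)$, $M$ can be smoothly parametrized on some square $(-\varepsilon,\varepsilon)^2$ by $$\psi(x,y)=\alpha(x)+y\,T_0, \qquad (*)$$ where $\alpha$ is a smooth lightlike curve (i.e. $\alpha'(x)$ is lightlike for every $x$), $T_0$ is a constant lightlike vector, and $\alpha'(x)$, $T_0$ are linearly independent for every $x$. (2) Conversely, let a surface $M$ be parametrized by $(*)$, with $\alpha$ and $T_0$ as in (1) and with $(x,y)$ ranging over an open set $U\subset\mathbb{R}^2$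 whose projection to the $x$-axis is $I$. Then $M$ is timelike. If $Z$ is a constant spacelike vector with $\langle Z,T_0\rangle=0$, then $Z^{\top}=H(x)T_0$ for some smooth function $H:I\to\mathbb{R}$, and $Z$ defines a canonical null direction on $M$ if and only if $\langle Z,\alpha'(x)\rangle\neq 0$ for every $x\in I$. Moreover, for every compact $K\subset I$ there is a constant spacelike vector $Z$ with $\langle Z,T_0\rangle=0$ that defines a canonical null direction on the part $x\in K$ of $M$; in particular, $M$ has such a canonical null direction near each of its points. -/

import Mathlib

open scoped Manifold ContDiff

noncomputable section

/-- The vector space underlying the Minkowski space `ℝ^{n,1}`. Its Euclidean norm is used only for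
the topology and the smooth structure. -/
abbrev Mink (n : ℕ) : Type := EuclideanSpace ℝ (Fin (n + 1))

/-- The Minkowski metric `-dx₁² + dx₂² + ⋯ + dxₙ₊₁²`. -/
def mink {n : ℕ} (v w : Mink n) : ℝ := -(v 0 * w 0) + ∑ i : Fin n, v i.succ * w i.succ

/-- Lightlike vectors: nonzero and null. -/
def IsLightlike {n : ℕ} (v : Mink n) : Prop := v ≠ 0 ∧ mink v v = 0

/-- Spacelike vectors. -/
def IsSpacelike {n : ℕ} (v : Mink n) : Prop := 0 < mink v v

section Surface

variable {n : ℕ} {M : Type*} [TopologicalSpace M] [ChartedSpace (EuclideanSpace ℝ (Fin 2)) M]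

/-- The differential at `p` of a map `f` from a surface to Minkowski space. -/
def surfDeriv (f : M → Mink n) (p : M) : TangentSpace (𝓡 2) p →L[ℝ] Mink n :=
  mfderiv (𝓡 2) 𝓘(ℝ, Mink n) f p

/-- The tangent plane at `p` of the surface immersed by `f`, as a subspace of Minkowski space. -/
def tangentPlane (f : M → Mink n) (p : M) : Submodule ℝ (Mink n) :=
  LinearMap.range (surfDeriv f p).toLinearMap

/-- The metric induced by `f` on `T_p M` has signature `(1,1)`: it has an orthonormal basis with
one negative and one positive vector. -/
def IsLorentzianAt (f : M → Mink n) (p : M) : Prop :=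
  ∃ b : Module.Basis (Fin 2) ℝ (TangentSpace (𝓡 2) p),
    mink (surfDeriv f p (b 0)) (surfDeriv f p (b 0)) = -1 ∧
    mink (surfDeriv f p (b 1)) (surfDeriv f p (b 1)) = 1 ∧
    mink (surfDeriv f p (b 0)) (surfDeriv f p (b 1)) = 0

/-- On the open set `V` of the two-dimensional manifold `M`, the map `f` is a smooth immersion whose
induced metric is Lorentzian, that is, `f` immerses `V` as a timelike surface. -/
structure IsTimelikeSurfaceOn (f : M → Mink n) (V : Set M) : Prop where
  smooth : ContMDiffOn (𝓡 2) 𝓘(ℝ, Mink n) ∞ f V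
  immersion : ∀ p ∈ V, Function.Injective (surfDeriv f p)
  lorentzian : ∀ p ∈ V, IsLorentzianAt f p

/-- `v` is the tangent part `Z^⊤` at `p` of the vector `Z`: it is tangent and `Z - v` is normal.
At points where the induced metric is Lorentzian there is exactly one such `v`. -/
def IsTangentPart (f : M → Mink n) (p : M) (Z v : Mink n) : Prop :=
  v ∈ tangentPlane f p ∧ ∀ w ∈ tangentPlane f p, mink (Z - v) w = 0

/-- The part over `V` of the surface immersed by `f` has a canonical null direction with respect to
the constant vector `Z`: the tangent part of `Z` is lightlike at every point of `V`. -/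
def HasCanonicalNullDirectionOn (f : M → Mink n) (V : Set M) (Z : Mink n) : Prop :=
  ∀ p ∈ V, ∃ v : Mink n, IsTangentPart f p Z v ∧ IsLightlike v

/-- In the local coordinates `(x, y)` given by the diffeomorphism `Φ` from an open subset of `ℝ²`
onto an open subset of `M`, the surface is `ψ(x, y) = α(x) + y T₀`, where `α` is a lightlike curve
and `T₀` is a constant lightlike vector, linearly independent of `α'(x)` for every `x`. -/
structure IsNullCylinderParametrization (f : M → Mink n)
    (Φ : PartialDiffeomorph 𝓘(ℝ, ℝ × ℝ) (𝓡 2) (ℝ × ℝ) M ∞) (α : ℝ → Mink n) (T₀ : Mink n) :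
    Prop where
  smooth_curve : ContDiffOn ℝ ∞ α (Prod.fst '' Φ.source)
  lightlike_curve : ∀ x ∈ Prod.fst '' Φ.source, IsLightlike (deriv α x)
  lightlike_vector : IsLightlike T₀
  independent : ∀ x ∈ Prod.fst '' Φ.source, LinearIndependent ℝ ![deriv α x, T₀]
  eq : ∀ q ∈ Φ.source, f (Φ q) = α q.1 + q.2 • T₀

end Surface

end

/-! If the tangent part `v` of `Z` is lightlike, then `⟨Z, v⟩ = ⟨v, v⟩ = 0`. Lightlike vectors
orthogonal to a nonzero `Z` in `ℝ^{2,1}` span at most two lines (`mink_eq_zero_or_of_orthogonal`),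
so the direction of `v` can only jump between two values. It does not jump near `p`: the second
line, if there is one, is not tangent at `p`, and non-tangency is an open condition. Hence one
constant lightlike `T₀` is tangent to the surface near `p`. The inverse function theorem gives
coordinates with `∂_y f = T₀` and `⟨T₀, ∂_x f⟩ = 1`, so `f = β(x) + y T₀`. Sliding `β` along the
rulings, `α = β + k T₀` with `k' = -⟨β', β'⟩ / 2`, makes the curve lightlike.

Conversely, `α'` and `T₀` form a null basis of each tangent plane with `⟨α', T₀⟩ ≠ 0`. For `Z ⊥ T₀`
this forces `Z^⊤ = H T₀` with `H = ⟨Z, α'⟩ / ⟨T₀, α'⟩`. Adding `c T₀` to `Z` changes `H` by `c` and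
keeps `⟨Z, Z⟩`, so on a compact set `H` can be made nonvanishing. -/

/-! ### Algebra of lightlike vectors in Minkowski space. -/

theorem mink_eq (v w : Mink 2) : mink v w = -(v 0 * w 0) + v 1 * w 1 + v 2 * w 2 := by
  simp [mink, Fin.sum_univ_two, add_assoc]

theorem mink_comm {n : ℕ} (v w : Mink n) : mink v w = mink w v := by
  simp [mink, mul_comm]

theorem mink_add_right {n : ℕ} (u v w : Mink n) : mink u (v + w) = mink u v + mink u w := by
  simp only [mink, PiLp.add_apply, mul_add, Finset.sum_add_distrib]
  ring

theorem mink_smul_right {n : ℕ} (c : ℝ) (v w : Mink n) : mink v (c • w) = c * mink v w := by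
  simp only [mink, PiLp.smul_apply, smul_eq_mul, mul_add, Finset.mul_sum]
  congr 1
  · ring
  · exact Finset.sum_congr rfl fun i _ ↦ by ring

theorem mink_add_left {n : ℕ} (u v w : Mink n) : mink (u + v) w = mink u w + mink v w := by
  rw [mink_comm, mink_add_right, mink_comm w u, mink_comm w v]

theorem mink_smul_left {n : ℕ} (c : ℝ) (v w : Mink n) : mink (c • v) w = c * mink v w := by
  rw [mink_comm, mink_smul_right, mink_comm]

theorem mink_sub_left {n : ℕ} (u v w : Mink n) : mink (u - v) w = mink u w - mink v w := by
  rw [sub_eq_add_neg, ← neg_one_smul ℝ v, mink_add_left, mink_smul_left]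
  ring

theorem mink_zero_right {n : ℕ} (v : Mink n) : mink v 0 = 0 := by
  simp [mink]

/-- Pairing with a fixed vector, as a continuous linear functional. -/
noncomputable def minkCLM {n : ℕ} (v : Mink n) : Mink n →L[ℝ] ℝ :=
  LinearMap.toContinuousLinearMap
    { toFun := mink v
      map_add' := mink_add_right v
      map_smul' := fun c w ↦ mink_smul_right c v w }

theorem ContDiffOn.mink {n : ℕ} {E : Type*} [NormedAddCommGroup E] [NormedSpace ℝ E]
    {g h : E → Mink n} {s : Set E} {k : WithTop ℕ∞} (hg : ContDiffOn ℝ k g s)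
    (hh : ContDiffOn ℝ k h s) : ContDiffOn ℝ k (fun x ↦ mink (g x) (h x)) s := by
  rw [contDiffOn_euclidean] at hg hh
  unfold _root_.mink
  exact ((hg 0).mul (hh 0)).neg.add (ContDiffOn.sum fun i _ ↦ (hg i.succ).mul (hh i.succ))

/-- With no time component, nullness is a vanishing sum of two squares. -/
theorem IsLightlike.apply_zero_ne {v : Mink 2} (hv : IsLightlike v) : v 0 ≠ 0 := by
  intro h
  apply hv.1
  have h2 := hv.2
  rw [mink_eq, h] at h2
  have h1 : v 1 = 0 := by nlinarith [sq_nonneg (v 1), sq_nonneg (v 2)]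
  have h3 : v 2 = 0 := by nlinarith [sq_nonneg (v 1), sq_nonneg (v 2)]
  ext i
  fin_cases i <;> assumption

/-- Orthogonal lightlike vectors are parallel. -/
theorem IsLightlike.exists_smul_eq_of_mink_eq_zero {v w : Mink 2} (hv : IsLightlike v)
    (hw : IsLightlike w) (h : mink v w = 0) : ∃ c : ℝ, c ≠ 0 ∧ w = c • v := by
  have hv0 := hv.apply_zero_ne
  refine ⟨w 0 / v 0, div_ne_zero hw.apply_zero_ne hv0, ?_⟩
  by_contra hne
  -- The difference is null with time coordinate zero, which a nonzero null vector cannot have.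
  have hu : IsLightlike (w + (-(w 0 / v 0)) • v) := by
    refine ⟨fun h0 ↦ hne ?_, ?_⟩
    · rw [neg_smul, ← sub_eq_add_neg] at h0
      exact sub_eq_zero.1 h0
    · simp only [mink_add_left, mink_add_right, mink_smul_left, mink_smul_right, hv.2, hw.2, h,
        mink_comm w v]
      ring
  apply hu.apply_zero_ne
  simp [hv0]

theorem IsLightlike.mink_ne_zero {v w : Mink 2} (hv : IsLightlike v) (hw : IsLightlike w)
    (h : LinearIndependent ℝ ![v, w]) : mink v w ≠ 0 := by
  intro h0
  obtain ⟨c, -, rfl⟩ := hv.exists_smul_eq_of_mink_eq_zero hw h0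
  rw [LinearIndependent.pair_iff] at h
  simpa using (h c (-1) (by simp)).2

theorem linearIndependent_of_mink_ne_zero {v w : Mink 2} (hv : IsLightlike v)
    (hw : IsLightlike w) (h : mink v w ≠ 0) : LinearIndependent ℝ ![v, w] := by
  rw [LinearIndependent.pair_iff]
  intro s t hst
  have h1 := congrArg (mink v) hst
  have h2 := congrArg (mink w) hst
  simp only [mink_add_right, mink_smul_right, hv.2, hw.2, mink_zero_right, mink_comm w v] at h1 h2
  simp_all

/-- The lightlike directions orthogonal to a fixed nonzero vector lie on at most two lines. -/
theorem mink_eq_zero_or_of_orthogonal {Z t u v : Mink 2} (hZ : Z ≠ 0) (ht : IsLightlike t)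
    (hu : IsLightlike u) (hv : IsLightlike v) (htZ : mink t Z = 0) (huZ : mink u Z = 0)
    (hvZ : mink v Z = 0) : mink t u = 0 ∨ mink t v = 0 ∨ mink u v = 0 := by
  set D : ℝ := t 0 * (u 1 * v 2 - u 2 * v 1) - t 1 * (u 0 * v 2 - u 2 * v 0)
    + t 2 * (u 0 * v 1 - u 1 * v 0) with hD
  have hD0 : D = 0 := by
    by_contra hne
    apply hZ
    rw [mink_eq] at htZ huZ hvZ
    -- Cramer's rule: the coefficients are cofactors of the matrix with rows `t`, `u`, `v`.
    have h0 : D * Z 0 = 0 := by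
      rw [hD]
      linear_combination -(u 1 * v 2 - u 2 * v 1) * htZ + (t 1 * v 2 - t 2 * v 1) * huZ
        - (t 1 * u 2 - t 2 * u 1) * hvZ
    have h1 : D * Z 1 = 0 := by
      rw [hD]
      linear_combination -(u 0 * v 2 - u 2 * v 0) * htZ + (t 0 * v 2 - t 2 * v 0) * huZ
        - (t 0 * u 2 - t 2 * u 0) * hvZ
    have h2 : D * Z 2 = 0 := by
      rw [hD]
      linear_combination (u 0 * v 1 - u 1 * v 0) * htZ - (t 0 * v 1 - t 1 * v 0) * huZ
        + (t 0 * u 1 - t 1 * u 0) * hvZ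
    ext i
    fin_cases i
    · exact (mul_eq_zero.1 h0).resolve_left hne
    · exact (mul_eq_zero.1 h1).resolve_left hne
    · exact (mul_eq_zero.1 h2).resolve_left hne
  have hgram : 2 * (mink t u * (mink t v * mink u v)) = 0 := by
    have h1 := ht.2
    have h2 := hu.2
    have h3 := hv.2
    -- The Gram determinant is `-D ^ 2`; with a null diagonal it reduces to `2⟨t,u⟩⟨t,v⟩⟨u,v⟩`.
    have key : mink t t * (mink u u * mink v v - mink u v * mink u v)
        - mink t u * (mink t u * mink v v - mink u v * mink t v)
        + mink t v * (mink t u * mink u v - mink u u * mink t v) = -D ^ 2 := by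
      simp only [mink_eq, hD]
      ring
    rw [h1, h2, h3, hD0] at key
    linear_combination key
  simpa using hgram

/-- A tangent vector of a Lorentzian plane that is orthogonal to a lightlike tangent vector is a
multiple of it. -/
theorem exists_smul_eq_of_isLorentzianAt {M : Type*} [TopologicalSpace M]
    [ChartedSpace (EuclideanSpace ℝ (Fin 2)) M] {n : ℕ} {f : M → Mink n} {p : M}
    (hp : IsLorentzianAt f p) {t v : Mink n} (ht : t ∈ tangentPlane f p) (htl : IsLightlike t)
    (hv : v ∈ tangentPlane f p) (h : mink t v = 0) : ∃ c : ℝ, v = c • t := by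
  obtain ⟨b, h0, h1, h01⟩ := hp
  have hmem : ∀ w ∈ tangentPlane f p, ∃ x y : ℝ,
      w = x • surfDeriv f p (b 0) + y • surfDeriv f p (b 1) := by
    rintro w ⟨z, rfl⟩
    refine ⟨b.repr z 0, b.repr z 1, ?_⟩
    have hz := congrArg (surfDeriv f p) (b.sum_repr z)
    rw [Fin.sum_univ_two, map_add, map_smul, map_smul] at hz
    exact hz.symm
  obtain ⟨x, y, hxy⟩ := hmem t ht
  obtain ⟨x', y', hxy'⟩ := hmem v hv
  generalize surfDeriv f p (b 0) = e₀ at *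
  generalize surfDeriv f p (b 1) = e₁ at *
  have h10 : mink e₁ e₀ = 0 := by rw [mink_comm, h01]
  have htt := htl.2
  have ht0 := htl.1
  rw [hxy] at htt h
  rw [hxy'] at h
  simp only [mink_add_left, mink_add_right, mink_smul_left, mink_smul_right, h0, h1, h01, h10]
    at htt h
  -- Here `htt` says `y² = x²` and `h` says `y y' = x x'`, so `(x', y')` is proportional to `(x,
  -- y)`.
  have hx : x ≠ 0 := by
    rintro rfl
    have : y = 0 := by nlinarith [sq_nonneg y]
    exact ht0 (by rw [hxy, this]; simp)
  have hy : y ≠ 0 := by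
    rintro rfl
    exact hx (by nlinarith [sq_nonneg x])
  refine ⟨x' / x, ?_⟩
  have hc : y' = x' / x * y := by
    field_simp
    apply mul_left_cancel₀ hy
    linear_combination x * h - x' * htt
  rw [hxy, hxy', smul_add, smul_smul, smul_smul, ← hc, div_mul_cancel₀ _ hx]

/-! ### Inverse function theorem and coordinate expressions on surfaces. -/

/-- The inverse function theorem, as a local diffeomorphism. -/
theorem ContDiffOn.exists_partialDiffeomorph {E F : Type*} [NormedAddCommGroup E]
    [NormedSpace ℝ E] [CompleteSpace E] [NormedAddCommGroup F] [NormedSpace ℝ F] {g : E → F}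
    {s : Set E} {a : E} (hs : IsOpen s) (ha : a ∈ s) (hg : ContDiffOn ℝ ∞ g s) {g' : E ≃L[ℝ] F}
    (hg' : fderiv ℝ g a = g') :
    ∃ Θ : PartialDiffeomorph 𝓘(ℝ, E) 𝓘(ℝ, F) E F ∞, a ∈ Θ.source ∧ Θ.source ⊆ s ∧
      ∀ x, Θ x = g x := by
  have hga : ContDiffAt ℝ ∞ g a := hg.contDiffAt (hs.mem_nhds ha)
  have hda : HasFDerivAt g (g' : E →L[ℝ] F) a :=
    hg' ▸ (hga.differentiableAt (by simp)).hasFDerivAt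
  set e := hga.toOpenPartialHomeomorph g hda (by simp)
  -- Restricting to points with invertible derivative makes the inverse smooth on the whole target,
  -- not only at the image of `a`.
  have hopen : IsOpen (s ∩ fderiv ℝ g ⁻¹' Set.range ((↑) : (E ≃L[ℝ] F) → E →L[ℝ] F)) :=
    (hg.continuousOn_fderiv_of_isOpen hs (by simp)).isOpen_inter_preimage hs
      ContinuousLinearEquiv.isOpen
  set e' := e.restrOpen _ hopen
  have hsub : e'.source ⊆ s ∩ fderiv ℝ g ⁻¹' Set.range ((↑) : (E ≃L[ℝ] F) → E →L[ℝ] F) :=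
    Set.inter_subset_right
  refine ⟨{ e' with
    contMDiffOn_toFun := ?_
    contMDiffOn_invFun := ?_ }, ?_, fun x hx ↦ (hsub hx).1, fun x ↦ rfl⟩
  · exact (hg.mono fun x hx ↦ (hsub hx).1).contMDiffOn
  · refine ContDiffOn.contMDiffOn fun y hy ↦ ContDiffAt.contDiffWithinAt ?_
    have hy' := hsub (e'.map_target hy)
    obtain ⟨g'', hg''⟩ := hy'.2
    have hat : ContDiffAt ℝ ∞ g (e'.symm y) := hg.contDiffAt (hs.mem_nhds hy'.1)
    exact e'.contDiffAt_symm (f₀' := g'') hy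
      (hg'' ▸ (hat.differentiableAt (by simp)).hasFDerivAt) hat
  · exact ⟨hga.mem_toOpenPartialHomeomorph_source hda (by simp), ha, g', hg'.symm⟩

section Surface

variable {M : Type*} [TopologicalSpace M] [ChartedSpace (EuclideanSpace ℝ (Fin 2)) M]

/-- The chart at a point, as a partial diffeomorphism from the model space. -/
def chartPartialDiffeomorph [IsManifold (𝓡 2) ∞ M] (p : M) :
    PartialDiffeomorph 𝓘(ℝ, EuclideanSpace ℝ (Fin 2)) (𝓡 2) (EuclideanSpace ℝ (Fin 2)) M ∞ where
  toPartialEquiv := (chartAt (EuclideanSpace ℝ (Fin 2)) p).symm.toPartialEquiv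
  open_source := (chartAt (EuclideanSpace ℝ (Fin 2)) p).open_target
  open_target := (chartAt (EuclideanSpace ℝ (Fin 2)) p).open_source
  contMDiffOn_toFun := contMDiffOn_chart_symm
  contMDiffOn_invFun := contMDiffOn_chart

variable {E : Type*} [NormedAddCommGroup E] [NormedSpace ℝ E]
  {F : Type*} [NormedAddCommGroup F] [NormedSpace ℝ F]

/-- In a parametrization `Φ`, the differential of a map is that of its coordinate expression. -/
theorem exists_mfderiv_eq_fderiv_comp (Φ : PartialDiffeomorph 𝓘(ℝ, E) (𝓡 2) E M ∞) {q : E}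
    (hq : q ∈ Φ.source) {f : M → F} (hf : MDifferentiableAt (𝓡 2) 𝓘(ℝ, F) f (Φ q)) :
    ∃ e : E ≃L[ℝ] TangentSpace (𝓡 2) (Φ q),
      ∀ v, mfderiv (𝓡 2) 𝓘(ℝ, F) f (Φ q) (e v) = fderiv ℝ (fun z ↦ f (Φ z)) q v := by
  have h : IsLocalDiffeomorphAt 𝓘(ℝ, E) (𝓡 2) ∞ Φ q := ⟨Φ, hq, Set.eqOn_refl _ _⟩
  refine ⟨h.mfderivToContinuousLinearEquiv (by simp), fun v ↦ ?_⟩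
  have hc := mfderiv_comp q hf (Φ.mdifferentiableAt (by simp) hq)
  rw [mfderiv_eq_fderiv] at hc
  exact (congrArg (fun A ↦ A v) hc).symm

/-- The inverse function theorem for maps from a surface. -/
theorem exists_partialDiffeomorph_of_mfderiv_injective [IsManifold (𝓡 2) ∞ M]
    [FiniteDimensional ℝ F] (hF : Module.finrank ℝ F = 2) {u : M → F}
    (hu : ContMDiff (𝓡 2) 𝓘(ℝ, F) ∞ u) (p : M)
    (hp : Function.Injective (mfderiv (𝓡 2) 𝓘(ℝ, F) u p)) :
    ∃ Φ : PartialDiffeomorph 𝓘(ℝ, F) (𝓡 2) F M ∞, u p ∈ Φ.source ∧ Φ (u p) = p ∧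
      ∀ z ∈ Φ.source, u (Φ z) = z := by
  set c := chartPartialDiffeomorph p
  set a : EuclideanSpace ℝ (Fin 2) := chartAt (EuclideanSpace ℝ (Fin 2)) p p
  have ha : a ∈ c.source := mem_chart_target _ p
  have hca : c a = p := (chartAt (EuclideanSpace ℝ (Fin 2)) p).left_inv (mem_chart_source _ p)
  have hg : ContDiffOn ℝ ∞ (fun z ↦ u (c z)) c.source :=
    contMDiffOn_iff_contDiffOn.1 (hu.comp_contMDiffOn c.contMDiffOn)
  obtain ⟨e, he⟩ := exists_mfderiv_eq_fderiv_comp c ha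
    (hu.mdifferentiableAt (by simp) (x := c a))
  have hinj : Function.Injective (fderiv ℝ (fun z ↦ u (c z)) a) := by
    intro v w hvw
    rw [← he, ← he] at hvw
    rw [← hca] at hp
    exact e.injective (hp hvw)
  let g' : EuclideanSpace ℝ (Fin 2) ≃L[ℝ] F :=
    (LinearEquiv.ofInjectiveOfFinrankEq (fderiv ℝ (fun z ↦ u (c z)) a).toLinearMap hinj
      (by simp [hF])).toContinuousLinearEquiv
  have hg' : fderiv ℝ (fun z ↦ u (c z)) a = g' := by
    ext v
    rfl
  obtain ⟨Θ, haΘ, hsub, hΘ⟩ := hg.exists_partialDiffeomorph c.open_source ha hg'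
  have hua : Θ a = u p := by rw [hΘ, hca]
  refine ⟨Θ.symm.trans c, ?_, ?_, ?_⟩
  · refine ⟨hua ▸ Θ.map_source haΘ, ?_⟩
    change Θ.invFun (u p) ∈ c.source
    rwa [← hua, show Θ.invFun (Θ a) = a from Θ.left_inv haΘ]
  · change c (Θ.invFun (u p)) = p
    rw [← hua, show Θ.invFun (Θ a) = a from Θ.left_inv haΘ, hca]
  · intro z hz
    change u (c (Θ.invFun z)) = z
    rw [← hΘ]
    exact Θ.right_inv hz.1

end Surface

/-! ### Geometry of a null cylinder `α(x) + y T₀`. -/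

section Surface

variable {M : Type*} [TopologicalSpace M] [ChartedSpace (EuclideanSpace ℝ (Fin 2)) M]
  {f : M → Mink 2} {Φ : PartialDiffeomorph 𝓘(ℝ, ℝ × ℝ) (𝓡 2) (ℝ × ℝ) M ∞}

theorem tangentPlane_eq_range_fderiv {q : ℝ × ℝ} (hq : q ∈ Φ.source)
    (hf : MDifferentiableAt (𝓡 2) 𝓘(ℝ, Mink 2) f (Φ q)) :
    tangentPlane f (Φ q) = LinearMap.range (fderiv ℝ (fun z ↦ f (Φ z)) q).toLinearMap := by
  obtain ⟨e, he⟩ := exists_mfderiv_eq_fderiv_comp Φ hq hf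
  ext w
  constructor
  · rintro ⟨v, rfl⟩
    refine ⟨e.symm v, ?_⟩
    change fderiv ℝ (fun z ↦ f (Φ z)) q (e.symm v) = _
    rw [← he, e.apply_symm_apply]
    rfl
  · rintro ⟨v, rfl⟩
    exact ⟨e v, he v⟩

theorem isLorentzianAt_of_fderiv {q : ℝ × ℝ} (hq : q ∈ Φ.source)
    (hf : MDifferentiableAt (𝓡 2) 𝓘(ℝ, Mink 2) f (Φ q)) {u v : ℝ × ℝ}
    (hli : LinearIndependent ℝ ![u, v])
    (hu : mink (fderiv ℝ (fun z ↦ f (Φ z)) q u) (fderiv ℝ (fun z ↦ f (Φ z)) q u) = -1)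
    (hv : mink (fderiv ℝ (fun z ↦ f (Φ z)) q v) (fderiv ℝ (fun z ↦ f (Φ z)) q v) = 1)
    (huv : mink (fderiv ℝ (fun z ↦ f (Φ z)) q u) (fderiv ℝ (fun z ↦ f (Φ z)) q v) = 0) :
    IsLorentzianAt f (Φ q) := by
  obtain ⟨e, he⟩ := exists_mfderiv_eq_fderiv_comp Φ hq hf
  let b : Module.Basis (Fin 2) ℝ (ℝ × ℝ) :=
    basisOfLinearIndependentOfCardEqFinrank hli (by simp)
  have hb : ∀ i, surfDeriv f (Φ q) (b.map e.toLinearEquiv i)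
      = fderiv ℝ (fun z ↦ f (Φ z)) q (![u, v] i) := fun i ↦ by
    rw [Module.Basis.map_apply, coe_basisOfLinearIndependentOfCardEqFinrank]
    exact he _
  refine ⟨b.map e.toLinearEquiv, ?_, ?_, ?_⟩
  · rw [hb]; exact hu
  · rw [hb]; exact hv
  · rw [hb, hb]; exact huv

namespace IsNullCylinderParametrization

variable {α : ℝ → Mink 2} {T₀ : Mink 2} (h : IsNullCylinderParametrization f Φ α T₀)
include h

theorem contDiffOn_deriv : ContDiffOn ℝ ∞ (deriv α) (Prod.fst '' Φ.source) :=
  ((contDiffOn_infty_iff_deriv_of_isOpen (isOpenMap_fst _ Φ.open_source)).1 h.smooth_curve).2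

theorem mink_deriv_ne_zero {x : ℝ} (hx : x ∈ Prod.fst '' Φ.source) : mink (deriv α x) T₀ ≠ 0 :=
  (h.lightlike_curve x hx).mink_ne_zero h.lightlike_vector (h.independent x hx)

theorem contMDiffOn : ContMDiffOn (𝓡 2) 𝓘(ℝ, Mink 2) ∞ f Φ.target := by
  have hψ : ContDiffOn ℝ ∞ (fun z : ℝ × ℝ ↦ α z.1 + z.2 • T₀) Φ.source :=
    (h.smooth_curve.comp contDiffOn_fst fun z hz ↦ Set.mem_image_of_mem _ hz).add
      (contDiffOn_snd.smul contDiffOn_const)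
  refine (hψ.contMDiffOn.comp Φ.contMDiffOn_invFun fun p hp ↦ Φ.map_target hp).congr
    fun p hp ↦ ?_
  have h1 := h.eq _ (Φ.map_target hp)
  rw [Φ.right_inv hp] at h1
  exact h1

theorem mdifferentiableAt {q : ℝ × ℝ} (hq : q ∈ Φ.source) :
    MDifferentiableAt (𝓡 2) 𝓘(ℝ, Mink 2) f (Φ q) :=
  (h.contMDiffOn.contMDiffAt (Φ.open_target.mem_nhds (Φ.map_source hq))).mdifferentiableAt
    (by simp)

theorem fderiv_apply {q : ℝ × ℝ} (hq : q ∈ Φ.source) (v : ℝ × ℝ) :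
    fderiv ℝ (fun z ↦ f (Φ z)) q v = v.1 • deriv α q.1 + v.2 • T₀ := by
  have hα : HasDerivAt α (deriv α q.1) q.1 :=
    ((h.smooth_curve.contDiffAt ((isOpenMap_fst _ Φ.open_source).mem_nhds
      (Set.mem_image_of_mem _ hq))).differentiableAt (by simp)).hasDerivAt
  have h1 : HasFDerivAt (fun z : ℝ × ℝ ↦ α z.1 + z.2 • T₀)
      ((ContinuousLinearMap.fst ℝ ℝ ℝ).smulRight (deriv α q.1)
        + (ContinuousLinearMap.snd ℝ ℝ ℝ).smulRight T₀) q := by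
    refine HasFDerivAt.add ?_ ?_
    · have := hα.hasFDerivAt.comp q (hasFDerivAt_fst (𝕜 := ℝ) (p := q))
      convert! this using 1
    · exact hasFDerivAt_snd.smul_const T₀
  have h2 : (fun z ↦ f (Φ z)) =ᶠ[nhds q] fun z ↦ α z.1 + z.2 • T₀ :=
    Filter.eventuallyEq_of_mem (Φ.open_source.mem_nhds hq) h.eq
  rw [h2.fderiv_eq, h1.fderiv]
  simp

theorem mem_tangentPlane_iff {q : ℝ × ℝ} (hq : q ∈ Φ.source) (w : Mink 2) :
    w ∈ tangentPlane f (Φ q) ↔ ∃ a b : ℝ, w = a • deriv α q.1 + b • T₀ := by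
  rw [tangentPlane_eq_range_fderiv hq (h.mdifferentiableAt hq)]
  constructor
  · rintro ⟨v, rfl⟩
    exact ⟨v.1, v.2, h.fderiv_apply hq v⟩
  · rintro ⟨a, b, rfl⟩
    exact ⟨(a, b), h.fderiv_apply hq (a, b)⟩

theorem isTimelikeSurfaceOn : IsTimelikeSurfaceOn f Φ.target := by
  have hΦ : ∀ p ∈ Φ.target, ∃ q ∈ Φ.source, Φ q = p := fun p hp ↦
    ⟨Φ.invFun p, Φ.map_target hp, Φ.right_inv hp⟩
  refine ⟨h.contMDiffOn, fun p hp ↦ ?_, fun p hp ↦ ?_⟩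
  · obtain ⟨q, hq, rfl⟩ := hΦ p hp
    obtain ⟨e, he⟩ := exists_mfderiv_eq_fderiv_comp Φ hq (h.mdifferentiableAt hq)
    have hli := h.independent q.1 (Set.mem_image_of_mem _ hq)
    rw [LinearIndependent.pair_iff] at hli
    refine (injective_iff_map_eq_zero (surfDeriv f (Φ q))).2 fun v hv ↦ ?_
    have h1 := he (e.symm v)
    rw [e.apply_symm_apply, h.fderiv_apply hq] at h1
    obtain ⟨h2, h3⟩ := hli _ _ (h1.symm.trans hv)
    exact (map_eq_zero_iff e.symm e.symm.injective).1 (Prod.ext h2 h3)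
  · obtain ⟨q, hq, rfl⟩ := hΦ p hp
    have hx := Set.mem_image_of_mem Prod.fst hq
    have hc := h.mink_deriv_ne_zero hx
    have hα := (h.lightlike_curve _ hx).2
    have hT := h.lightlike_vector.2
    set c := mink (deriv α q.1) T₀ with hcdef
    have hc' : mink T₀ (deriv α q.1) = c := by rw [mink_comm, ← hcdef]
    -- In a null basis `⟨α' + s T₀, α' + s T₀⟩ = 2 s c`; the values `s = ∓1 / (2c)` give norms `∓1`
    -- and orthogonal vectors.
    refine isLorentzianAt_of_fderiv hq (h.mdifferentiableAt hq) (u := (1, -(1 / (2 * c))))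
      (v := (1, 1 / (2 * c))) ?_ ?_ ?_ ?_
    · rw [LinearIndependent.pair_iff]
      intro s t hst
      have h1 : s + t = 0 := by simpa using congrArg Prod.fst hst
      have h2 : s * -(1 / (2 * c)) + t * (1 / (2 * c)) = 0 := by
        simpa using congrArg Prod.snd hst
      field_simp at h2
      constructor <;> linarith
    all_goals
      simp only [h.fderiv_apply hq, mink_add_left, mink_add_right, mink_smul_left,
        mink_smul_right, hα, hT, hc', ← hcdef]
      field_simp
      ring

/-- Pairing `Z - (a α' + b T₀)` with `T₀` forces `a = 0`; pairing with `α'` then determines `b`. -/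
theorem isTangentPart_iff {q : ℝ × ℝ} (hq : q ∈ Φ.source) {Z : Mink 2} (hZ : mink Z T₀ = 0)
    (v : Mink 2) : IsTangentPart f (Φ q) Z v ↔
      v = (mink Z (deriv α q.1) / mink T₀ (deriv α q.1)) • T₀ := by
  have hx := Set.mem_image_of_mem Prod.fst hq
  have hc := h.mink_deriv_ne_zero hx
  rw [mink_comm] at hc
  have hα := (h.lightlike_curve _ hx).2
  have hT := h.lightlike_vector.2
  constructor
  · rintro ⟨hv, hvn⟩
    obtain ⟨a, b, rfl⟩ := (h.mem_tangentPlane_iff hq v).1 hv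
    have h1 := hvn (deriv α q.1) ((h.mem_tangentPlane_iff hq _).2 ⟨1, 0, by simp⟩)
    have h2 := hvn T₀ ((h.mem_tangentPlane_iff hq _).2 ⟨0, 1, by simp⟩)
    simp only [mink_sub_left, mink_add_left, mink_smul_left, hα, hT, hZ,
      mink_comm (deriv α q.1) T₀] at h1 h2
    have ha : a = 0 := by simpa [hc] using h2
    subst ha
    have hb : b = mink Z (deriv α q.1) / mink T₀ (deriv α q.1) := by
      field_simp
      linarith
    simp [hb]
  · rintro rfl
    refine ⟨(h.mem_tangentPlane_iff hq _).2 ⟨0, _, by rw [zero_smul, zero_add]⟩, fun w hw ↦ ?_⟩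
    obtain ⟨a, b, rfl⟩ := (h.mem_tangentPlane_iff hq w).1 hw
    simp only [mink_sub_left, mink_add_right, mink_smul_left, mink_smul_right, hT, hZ]
    field_simp
    ring

theorem exists_isTangentPart_lightlike_iff {q : ℝ × ℝ} (hq : q ∈ Φ.source) {Z : Mink 2}
    (hZ : mink Z T₀ = 0) :
    (∃ v, IsTangentPart f (Φ q) Z v ∧ IsLightlike v) ↔ mink Z (deriv α q.1) ≠ 0 := by
  have hc := h.mink_deriv_ne_zero (Set.mem_image_of_mem Prod.fst hq)
  rw [mink_comm] at hc
  constructor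
  · rintro ⟨v, hv, hvl⟩ h0
    rw [h.isTangentPart_iff hq hZ, h0, zero_div, zero_smul] at hv
    exact hvl.1 hv
  · intro h0
    refine ⟨_, (h.isTangentPart_iff hq hZ _).2 rfl,
      smul_ne_zero (div_ne_zero h0 hc) h.lightlike_vector.1, ?_⟩
    rw [mink_smul_left, mink_smul_right, h.lightlike_vector.2]
    ring

theorem contDiffOn_div (Z : Mink 2) :
    ContDiffOn ℝ ∞ (fun x ↦ mink Z (deriv α x) / mink T₀ (deriv α x)) (Prod.fst '' Φ.source) :=
  (contDiffOn_const.mink h.contDiffOn_deriv).div (contDiffOn_const.mink h.contDiffOn_deriv)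
    fun x hx ↦ by rw [mink_comm]; exact h.mink_deriv_ne_zero hx

theorem hasCanonicalNullDirectionOn_iff {Z : Mink 2} (hZ : mink Z T₀ = 0) :
    HasCanonicalNullDirectionOn f Φ.target Z ↔
      ∀ x ∈ Prod.fst '' Φ.source, mink Z (deriv α x) ≠ 0 := by
  constructor
  · rintro hN x ⟨q, hq, rfl⟩
    exact (h.exists_isTangentPart_lightlike_iff hq hZ).1 (hN _ (Φ.map_source hq))
  · intro hN p hp
    have hq := Φ.map_target hp
    have := (h.exists_isTangentPart_lightlike_iff hq hZ).2 (hN _ (Set.mem_image_of_mem _ hq))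
    rwa [Φ.right_inv hp] at this

theorem exists_hasCanonicalNullDirectionOn {K : Set ℝ} (hK : K ⊆ Prod.fst '' Φ.source)
    (hKc : IsCompact K) :
    ∃ Z : Mink 2, IsSpacelike Z ∧ mink Z T₀ = 0 ∧
      HasCanonicalNullDirectionOn f (Φ '' {q ∈ Φ.source | q.1 ∈ K}) Z := by
  -- The spatial part of `T₀` rotated by a right angle: orthogonal to `T₀`, with `⟨W, W⟩ = (T₀ 0)²`
  -- because `T₀` is null.
  set W : Mink 2 := !₂[0, -T₀ 2, T₀ 1] with hW
  have hWT : mink W T₀ = 0 := by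
    simp [mink_eq, hW]
    ring
  have hT := h.lightlike_vector.2
  have hWW : 0 < mink W W := by
    have h0 : 0 < T₀ 0 * T₀ 0 := mul_self_pos.2 h.lightlike_vector.apply_zero_ne
    rw [mink_eq] at hT
    simp [mink_eq, hW]
    linarith
  obtain ⟨C, hC⟩ := hKc.exists_bound_of_continuousOn ((h.contDiffOn_div W).continuousOn.mono hK)
  -- The coefficient of `W^⊤` is bounded by `C` on `K`, so adding `C + 1` keeps it away from zero.
  have hZT : mink (W + (C + 1) • T₀) T₀ = 0 := by
    rw [mink_add_left, mink_smul_left, hWT, hT]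
    ring
  refine ⟨W + (C + 1) • T₀, ?_, hZT, ?_⟩
  · unfold IsSpacelike
    rw [mink_add_right, mink_smul_right, hZT, mink_add_left, mink_smul_left, mink_comm T₀ W, hWT]
    linarith
  · rintro _ ⟨q, ⟨hq, hqK⟩, rfl⟩
    rw [h.exists_isTangentPart_lightlike_iff hq hZT, mink_add_left, mink_smul_left]
    have hc := h.mink_deriv_ne_zero (hK hqK)
    rw [mink_comm] at hc
    intro h0
    have h1 : mink W (deriv α q.1) / mink T₀ (deriv α q.1) = -(C + 1) := by
      rw [div_eq_iff hc]
      linarith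
    have h2 := hC _ hqK
    rw [h1, norm_neg] at h2
    linarith [Real.le_norm_self (C + 1)]

end IsNullCylinderParametrization

end Surface

/-! ### Local normal form of a surface with a canonical null direction. -/

theorem ContDiffOn.exists_hasDerivAt {φ : ℝ → ℝ} {δ : ℝ} (hδ : 0 < δ)
    (hφ : ContDiffOn ℝ ∞ φ (Set.Ioo (-δ) δ)) :
    ∃ k : ℝ → ℝ, k 0 = 0 ∧ ContDiffOn ℝ ∞ k (Set.Ioo (-δ) δ) ∧
      ∀ x ∈ Set.Ioo (-δ) δ, HasDerivAt k (φ x) x := by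
  have hk : ∀ x ∈ Set.Ioo (-δ) δ, HasDerivAt (fun x ↦ ∫ s in (0 : ℝ)..x, φ s) (φ x) x := by
    intro x hx
    have h0 : (0 : ℝ) ∈ Set.Ioo (-δ) δ := ⟨by linarith, hδ⟩
    have hsub : Set.uIcc 0 x ⊆ Set.Ioo (-δ) δ := Set.OrdConnected.uIcc_subset inferInstance h0 hx
    exact intervalIntegral.integral_hasDerivAt_right
      (hφ.continuousOn.mono hsub).intervalIntegrable
      (hφ.continuousOn.stronglyMeasurableAtFilter isOpen_Ioo x hx)
      (hφ.continuousOn.continuousAt (isOpen_Ioo.mem_nhds hx))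
  refine ⟨_, intervalIntegral.integral_same, ?_, hk⟩
  rw [contDiffOn_infty_iff_deriv_of_isOpen isOpen_Ioo]
  exact ⟨fun x hx ↦ (hk x hx).differentiableAt.differentiableWithinAt,
    hφ.congr fun x hx ↦ (hk x hx).deriv⟩

/-- The shear `(x, y) ↦ (x, y + k x)` on a square. -/
def shearPartialDiffeomorph {k : ℝ → ℝ} {ε : ℝ} (hk : ContDiffOn ℝ ∞ k (Set.Ioo (-ε) ε)) :
    PartialDiffeomorph 𝓘(ℝ, ℝ × ℝ) 𝓘(ℝ, ℝ × ℝ) (ℝ × ℝ) (ℝ × ℝ) ∞ where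
  toFun z := (z.1, z.2 + k z.1)
  invFun z := (z.1, z.2 - k z.1)
  source := Set.Ioo (-ε) ε ×ˢ Set.Ioo (-ε) ε
  target := Set.Ioo (-ε) ε ×ˢ Set.univ ∩ (fun z ↦ z.2 - k z.1) ⁻¹' Set.Ioo (-ε) ε
  map_source' z hz := by
    refine ⟨⟨hz.1, trivial⟩, ?_⟩
    simpa using hz.2
  map_target' z hz := ⟨hz.1.1, hz.2⟩
  left_inv' z _ := by simp
  right_inv' z _ := by simp
  open_source := isOpen_Ioo.prod isOpen_Ioo
  open_target :=
    (continuousOn_snd.sub (hk.continuousOn.comp continuousOn_fst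
      fun z hz ↦ hz.1)).isOpen_inter_preimage (isOpen_Ioo.prod isOpen_univ) isOpen_Ioo
  contMDiffOn_toFun :=
    (contDiffOn_fst.prodMk (contDiffOn_snd.add
      (hk.comp contDiffOn_fst fun z hz ↦ hz.1))).contMDiffOn
  contMDiffOn_invFun :=
    (contDiffOn_fst.prodMk (contDiffOn_snd.sub
      (hk.comp contDiffOn_fst fun z hz ↦ hz.1.1))).contMDiffOn

section Surface

variable {M : Type*} [TopologicalSpace M] [ChartedSpace (EuclideanSpace ℝ (Fin 2)) M]
  {f : M → Mink 2}

/-- A canonical null direction gives coordinates in which one coordinate vector field is a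
constant lightlike vector. -/
theorem IsTimelikeSurfaceOn.exists_constant_lightlike_coordinate [IsManifold (𝓡 2) ∞ M]
    (hf : IsTimelikeSurfaceOn f Set.univ) {Z : Mink 2}
    (hZ : HasCanonicalNullDirectionOn f Set.univ Z) (p : M) :
    ∃ (Ψ : PartialDiffeomorph 𝓘(ℝ, ℝ × ℝ) (𝓡 2) (ℝ × ℝ) M ∞) (T₀ : Mink 2) (δ : ℝ), 0 < δ ∧
      Set.Ioo (-δ) δ ×ˢ Set.Ioo (-δ) δ ⊆ Ψ.source ∧ Ψ 0 = p ∧ IsLightlike T₀ ∧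
      ∀ z ∈ Set.Ioo (-δ) δ ×ˢ Set.Ioo (-δ) δ, fderiv ℝ (fun z ↦ f (Ψ z)) z (0, 1) = T₀ ∧
        mink T₀ (fderiv ℝ (fun z ↦ f (Ψ z)) z (1, 0)) = 1 := by
  have hsm : ContMDiff (𝓡 2) 𝓘(ℝ, Mink 2) ∞ f := contMDiffOn_univ.1 hf.smooth
  have hmd : ∀ q, MDifferentiableAt (𝓡 2) 𝓘(ℝ, Mink 2) f q := hsm.mdifferentiable (by simp)
  choose! v hv hvl using fun q ↦ hZ q trivial
  -- `Z - v q` is normal and `v q` is tangent and null. No continuity of the choice `v` is available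
  -- or needed.
  have hvZ : ∀ q, mink (v q) Z = 0 := fun q ↦ by
    have h1 := (hv q).2 _ (hv q).1
    rwa [mink_sub_left, (hvl q).2, sub_zero, mink_comm] at h1
  set T₀ := v p with hT₀
  have hT0 : T₀ 0 ≠ 0 := (hvl p).apply_zero_ne
  -- On the tangent plane at `p` the kernel of `⟨T₀, ·⟩` is the line of `T₀`; the second component
  -- detects that line and is scaled so that `L T₀ = (0, 1)`.
  let L : Mink 2 →L[ℝ] ℝ × ℝ :=
    (minkCLM T₀).prod ((T₀ 0)⁻¹ • (EuclideanSpace.proj 0 : Mink 2 →L[ℝ] ℝ))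
  have hLT : L T₀ = (0, 1) := by
    refine Prod.ext ?_ ?_
    · exact (hvl p).2
    · simp [L, hT0]
  have hL1 : ∀ w, (L w).1 = mink T₀ w := fun w ↦ rfl
  have hA : ∀ w, HasFDerivAt (fun w ↦ L (w - f p)) L w := fun w ↦
    L.hasFDerivAt.comp w ((hasFDerivAt_id w).sub_const (f p))
  have hu : ContMDiff (𝓡 2) 𝓘(ℝ, ℝ × ℝ) ∞ (fun q ↦ L (f q - f p)) :=
    (L.contDiff.comp (contDiff_id.sub contDiff_const)).contMDiff.comp hsm
  have hinj : Function.Injective (mfderiv (𝓡 2) 𝓘(ℝ, ℝ × ℝ) (fun q ↦ L (f q - f p)) p) := by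
    have hc : mfderiv (𝓡 2) 𝓘(ℝ, ℝ × ℝ) (fun q ↦ L (f q - f p)) p = L.comp (surfDeriv f p) :=
      ((hA (f p)).hasMFDerivAt.comp p (hmd p).hasMFDerivAt).mfderiv
    rw [hc]
    refine (injective_iff_map_eq_zero (L.comp (surfDeriv f p))).2 fun x hx ↦ ?_
    have hx' : L (surfDeriv f p x) = 0 := hx
    obtain ⟨c, hcx⟩ := exists_smul_eq_of_isLorentzianAt (hf.lorentzian p trivial) (hv p).1
      (hvl p) ⟨x, rfl⟩ (show mink T₀ (surfDeriv f p x) = 0 by rw [← hL1, hx']; rfl)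
    have hcx' : surfDeriv f p x = c • T₀ := hcx
    rw [hcx', map_smul, hLT] at hx'
    have hc0 : c = 0 := by simpa using congrArg Prod.snd hx'
    rw [hc0, zero_smul] at hcx'
    exact (injective_iff_map_eq_zero (surfDeriv f p)).1 (hf.immersion p trivial) x hcx'
  obtain ⟨Ψ, h0Ψ, hΨ0, hΨ⟩ := exists_partialDiffeomorph_of_mfderiv_injective (by simp) hu p hinj
  rw [sub_self, map_zero] at h0Ψ hΨ0
  have hg : ContDiffOn ℝ ∞ (fun z ↦ f (Ψ z)) Ψ.source :=
    contMDiffOn_iff_contDiffOn.1 (hsm.comp_contMDiffOn Ψ.contMDiffOn)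
  set g := fun z ↦ f (Ψ z)
  have hLD : ∀ z ∈ Ψ.source, ∀ w, L (fderiv ℝ g z w) = w := by
    intro z hz w
    have hgz := ((hg.contDiffAt (Ψ.open_source.mem_nhds hz)).differentiableAt
      (by simp)).hasFDerivAt
    have h1 := (hA (g z)).comp z hgz
    have h2 : (fun w ↦ L (w - f p)) ∘ g =ᶠ[nhds z] id :=
      Filter.eventuallyEq_of_mem (Ψ.open_source.mem_nhds hz) hΨ
    have h3 := h1.unique ((hasFDerivAt_id z).congr_of_eventuallyEq h2)
    exact congrArg (fun A : ℝ × ℝ →L[ℝ] ℝ × ℝ ↦ A w) h3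
  -- Tangency of `w` at `Ψ z` becomes the equation `fderiv ℝ g z (L w) = w`, which is continuous in
  -- `z`.
  have hmem : ∀ z ∈ Ψ.source, ∀ w ∈ tangentPlane f (Ψ z), fderiv ℝ g z (L w) = w := by
    intro z hz w hw
    rw [tangentPlane_eq_range_fderiv hz (hmd _)] at hw
    obtain ⟨x, rfl⟩ := hw
    exact congrArg (fderiv ℝ g z) (hLD z hz x)
  have hΨn : ∀ᶠ z in nhds (0 : ℝ × ℝ), z ∈ Ψ.source := Ψ.open_source.mem_nhds h0Ψ
  have horth : ∀ᶠ z in nhds (0 : ℝ × ℝ), mink T₀ (v (Ψ z)) = 0 := by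
    -- `T₁` spans the second null line orthogonal to `Z`; without it every `v q` is orthogonal to
    -- `T₀`.
    by_cases hex : ∃ T₁, IsLightlike T₁ ∧ mink T₁ Z = 0 ∧ mink T₀ T₁ ≠ 0
    · obtain ⟨T₁, hT₁, hT₁Z, hT₀T₁⟩ := hex
      -- If `Z = 0`, then `T₀` is orthogonal to the tangent plane, so even the timelike basis vector
      -- would be a multiple of `T₀`.
      have hZ0 : Z ≠ 0 := by
        rintro rfl
        have h1 := (hv p).2
        refine (hf.lorentzian p trivial).elim fun b hb ↦ ?_
        obtain ⟨c, hc⟩ := exists_smul_eq_of_isLorentzianAt (hf.lorentzian p trivial) (hv p).1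
          (hvl p) ⟨b 0, rfl⟩ (by
            have h2 := h1 _ ⟨b 0, rfl⟩
            rw [zero_sub, ← neg_one_smul ℝ, mink_smul_left] at h2
            linarith)
        have hb0 : surfDeriv f p (b 0) = c • T₀ := hc
        have h3 := hb.1
        rw [hb0, mink_smul_left, mink_smul_right, (hvl p).2] at h3
        norm_num at h3
      -- If `T₁` were tangent at `p`, then `0 = ⟨Z - T₀, T₁⟩ = -⟨T₀, T₁⟩`.
      have hne : fderiv ℝ g 0 (L T₁) ≠ T₁ := by
        intro h1
        have hT₁p : T₁ ∈ tangentPlane f p := by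
          rw [← hΨ0, tangentPlane_eq_range_fderiv h0Ψ (hmd _)]
          exact ⟨_, h1⟩
        have h2 := (hv p).2 _ hT₁p
        rw [mink_sub_left, mink_comm Z, hT₁Z, zero_sub, neg_eq_zero] at h2
        exact hT₀T₁ h2
      have hcont : ContinuousAt (fun z ↦ fderiv ℝ g z (L T₁)) 0 :=
        ((hg.continuousOn_fderiv_of_isOpen Ψ.open_source (by simp)).continuousAt
          (Ψ.open_source.mem_nhds h0Ψ)).clm_apply continuousAt_const
      filter_upwards [hcont.eventually_ne hne, hΨn] with z hz hzΨ
      rcases mink_eq_zero_or_of_orthogonal hZ0 (hvl p) hT₁ (hvl (Ψ z)) (hvZ p) hT₁Z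
        (hvZ (Ψ z)) with h1 | h1 | h1
      · exact absurd h1 hT₀T₁
      · exact h1
      · rw [mink_comm] at h1
        obtain ⟨c, -, rfl⟩ := (hvl (Ψ z)).exists_smul_eq_of_mink_eq_zero hT₁ h1
        exact absurd (hmem z hzΨ _ (Submodule.smul_mem _ c (hv (Ψ z)).1)) hz
    · push Not at hex
      exact Filter.Eventually.of_forall fun z ↦ hex _ (hvl _) (hvZ _)
  obtain ⟨δ, hδ, hball⟩ := Metric.eventually_nhds_iff_ball.1 (hΨn.and horth)
  have hbox : ∀ z ∈ Set.Ioo (-δ) δ ×ˢ Set.Ioo (-δ) δ, z ∈ Metric.ball (0 : ℝ × ℝ) δ := by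
    rintro z ⟨⟨h1, h2⟩, h3, h4⟩
    rw [mem_ball_zero_iff, Prod.norm_def, max_lt_iff, Real.norm_eq_abs, Real.norm_eq_abs,
      abs_lt, abs_lt]
    exact ⟨⟨h1, h2⟩, h3, h4⟩
  refine ⟨Ψ, T₀, δ, hδ, fun z hz ↦ (hball z (hbox z hz)).1, hΨ0, hvl p, fun z hz ↦ ?_⟩
  obtain ⟨hzΨ, hzo⟩ := hball z (hbox z hz)
  constructor
  · rw [mink_comm] at hzo
    obtain ⟨c, -, hc⟩ := (hvl (Ψ z)).exists_smul_eq_of_mink_eq_zero (hvl p) hzo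
    have h1 := hmem z hzΨ T₀ (by
      rw [hT₀, hc]
      exact Submodule.smul_mem _ c (hv (Ψ z)).1)
    rwa [hLT] at h1
  · rw [← hL1, hLD z hzΨ]

theorem IsTimelikeSurfaceOn.exists_isNullCylinderParametrization [IsManifold (𝓡 2) ∞ M]
    (hf : IsTimelikeSurfaceOn f Set.univ) {Z : Mink 2}
    (hZ : HasCanonicalNullDirectionOn f Set.univ Z) (p : M) :
    ∃ (Φ : PartialDiffeomorph 𝓘(ℝ, ℝ × ℝ) (𝓡 2) (ℝ × ℝ) M ∞) (α : ℝ → Mink 2)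
      (T₀ : Mink 2) (ε : ℝ), 0 < ε ∧ Φ.source = Set.Ioo (-ε) ε ×ˢ Set.Ioo (-ε) ε ∧
        Φ (0, 0) = p ∧ IsNullCylinderParametrization f Φ α T₀ := by
  obtain ⟨Ψ, T₀, δ, hδ, hbox, hΨ0, hT₀, hD⟩ := hf.exists_constant_lightlike_coordinate hZ p
  have hg : ContDiffOn ℝ ∞ (fun z ↦ f (Ψ z)) (Set.Ioo (-δ) δ ×ˢ Set.Ioo (-δ) δ) :=
    contMDiffOn_iff_contDiffOn.1
      ((contMDiffOn_univ.1 hf.smooth).comp_contMDiffOn (Ψ.contMDiffOn.mono hbox))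
  set g := fun z ↦ f (Ψ z)
  have h0 : (0 : ℝ) ∈ Set.Ioo (-δ) δ := ⟨by linarith, hδ⟩
  have hgd : ∀ z ∈ Set.Ioo (-δ) δ ×ˢ Set.Ioo (-δ) δ, HasFDerivAt g (fderiv ℝ g z) z :=
    fun z hz ↦ ((hg.contDiffAt ((isOpen_Ioo.prod isOpen_Ioo).mem_nhds hz)).differentiableAt
      (by simp)).hasFDerivAt
  set β : ℝ → Mink 2 := fun s ↦ g (s, 0)
  have hβ : ContDiffOn ℝ ∞ β (Set.Ioo (-δ) δ) :=
    hg.comp (contDiffOn_id.prodMk contDiffOn_const) fun s hs ↦ ⟨hs, h0⟩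
  have hβd : ∀ s ∈ Set.Ioo (-δ) δ, HasDerivAt β (fderiv ℝ g (s, 0) (1, 0)) s := fun s hs ↦
    HasFDerivAt.comp_hasDerivAt (f := fun s : ℝ ↦ (s, (0 : ℝ))) s (hgd (s, 0) ⟨hs, h0⟩)
      ((hasDerivAt_id s).prodMk (hasDerivAt_const s (0 : ℝ)))
  have hβT : ∀ s ∈ Set.Ioo (-δ) δ, mink T₀ (deriv β s) = 1 := fun s hs ↦ by
    rw [(hβd s hs).deriv]
    exact (hD (s, 0) ⟨hs, h0⟩).2
  have hline : ∀ s ∈ Set.Ioo (-δ) δ, ∀ t ∈ Set.Ioo (-δ) δ, g (s, t) = β s + t • T₀ := by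
    intro s hs t ht
    have hd : ∀ t ∈ Set.Ioo (-δ) δ, HasDerivAt (fun t ↦ g (s, t) - t • T₀) 0 t := by
      intro t ht
      have h1 := (hgd (s, t) ⟨hs, ht⟩).comp_hasDerivAt t
        ((hasDerivAt_const t s).prodMk (hasDerivAt_id t))
      rw [(hD (s, t) ⟨hs, ht⟩).1] at h1
      have h2 := h1.sub ((hasDerivAt_id t).smul_const T₀)
      rwa [one_smul, sub_self] at h2
    have h3 := isOpen_Ioo.is_const_of_deriv_eq_zero isPreconnected_Ioo
      (fun t ht ↦ (hd t ht).differentiableAt.differentiableWithinAt)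
      (fun t ht ↦ (hd t ht).deriv) ht h0
    rw [zero_smul, sub_zero] at h3
    exact sub_eq_iff_eq_add.1 h3
  have hβ' : ContDiffOn ℝ ∞ (deriv β) (Set.Ioo (-δ) δ) :=
    ((contDiffOn_infty_iff_deriv_of_isOpen isOpen_Ioo).1 hβ).2
  -- Since `⟨T₀, β'⟩ = 1`, `⟨β' + k' T₀, β' + k' T₀⟩ = ⟨β', β'⟩ + 2k'`, which dictates `k'`; `k 0 =
  -- 0` keeps the origin over `p`.
  obtain ⟨k, hk0, hk, hkd⟩ := ContDiffOn.exists_hasDerivAt hδ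
    ((contDiffOn_const (c := (-1 / 2 : ℝ))).mul (hβ'.mink hβ'))
  have hkc : ContinuousAt k 0 := hk.continuousOn.continuousAt (isOpen_Ioo.mem_nhds h0)
  obtain ⟨η, hη, hkη⟩ := Metric.continuousAt_iff.1 hkc (δ / 2) (by linarith)
  -- Both `|y|` and `|k x|` stay below `δ / 2`, so the sheared square remains in the `δ`-box.
  set ε := min η (δ / 2)
  have hε0 : 0 < ε := lt_min hη (by linarith)
  have hεη : ε ≤ η := min_le_left _ _
  have hεδ : ε ≤ δ / 2 := min_le_right _ _
  have hsub : Set.Ioo (-ε) ε ⊆ Set.Ioo (-δ) δ := Set.Ioo_subset_Ioo (by linarith) (by linarith)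
  set σ := shearPartialDiffeomorph (hk.mono hsub)
  have hshear : ∀ z ∈ Set.Ioo (-ε) ε ×ˢ Set.Ioo (-ε) ε, z.2 + k z.1 ∈ Set.Ioo (-δ) δ := by
    rintro z ⟨⟨h1, h2⟩, h3, h4⟩
    have h5 := hkη (x := z.1) (by
      rw [dist_zero_right, Real.norm_eq_abs, abs_lt]
      constructor <;> linarith)
    rw [hk0, dist_zero_right, Real.norm_eq_abs, abs_lt] at h5
    constructor <;> linarith [h5.1, h5.2]
  have hsource : (σ.trans Ψ).source = Set.Ioo (-ε) ε ×ˢ Set.Ioo (-ε) ε :=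
    Set.inter_eq_left.2 fun z hz ↦ hbox ⟨hsub hz.1, hshear z hz⟩
  have hfst : Prod.fst '' (σ.trans Ψ).source = Set.Ioo (-ε) ε := by
    rw [hsource]
    exact Set.fst_image_prod _ ⟨0, by linarith, hε0⟩
  have hαd : ∀ x ∈ Set.Ioo (-δ) δ, deriv (fun x ↦ β x + k x • T₀) x
      = deriv β x + (-1 / 2 * mink (deriv β x) (deriv β x)) • T₀ := fun x hx ↦
    (((hβd x hx).differentiableAt.hasDerivAt).add ((hkd x hx).smul_const T₀)).deriv
  have hTα : ∀ x ∈ Set.Ioo (-δ) δ, mink T₀ (deriv (fun x ↦ β x + k x • T₀) x) = 1 := by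
    intro x hx
    rw [hαd x hx, mink_add_right, mink_smul_right, hT₀.2, hβT x hx]
    ring
  have hα : ∀ x ∈ Set.Ioo (-δ) δ, IsLightlike (deriv (fun x ↦ β x + k x • T₀) x) := by
    refine fun x hx ↦ ⟨fun h1 ↦ ?_, ?_⟩
    · have h2 := hTα x hx
      rw [h1, mink_zero_right] at h2
      exact zero_ne_one h2
    · rw [hαd x hx]
      simp only [mink_add_left, mink_add_right, mink_smul_left, mink_smul_right, hT₀.2, hβT x hx,
        mink_comm (deriv β x) T₀]
      ring
  refine ⟨σ.trans Ψ, fun x ↦ β x + k x • T₀, T₀, ε, hε0, hsource, ?_, ?_, ?_, hT₀, ?_, ?_⟩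
  · change Ψ (0, 0 + k 0) = p
    rw [hk0, add_zero]
    exact hΨ0
  · rw [hfst]
    exact (hβ.add (hk.smul contDiffOn_const)).mono hsub
  · rw [hfst]
    exact fun x hx ↦ hα x (hsub hx)
  · rw [hfst]
    refine fun x hx ↦ linearIndependent_of_mink_ne_zero (hα x (hsub hx)) hT₀ ?_
    rw [mink_comm, hTα x (hsub hx)]
    exact one_ne_zero
  · rw [hsource]
    intro q hq
    change g (q.1, q.2 + k q.1) = _
    rw [hline _ (hsub hq.1) _ (hshear q hq), add_smul]
    abel

end Surface

theorem mainTheorem5 {M : Type*} [TopologicalSpace M]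
    [ChartedSpace (EuclideanSpace ℝ (Fin 2)) M] [IsManifold (𝓡 2) ∞ M] (f : M → Mink 2) :
    -- a timelike surface with a canonical null direction is locally a cylinder
    (IsTimelikeSurfaceOn f Set.univ →
      ∀ Z : Mink 2, HasCanonicalNullDirectionOn f Set.univ Z →
        ∀ p : M, ∃ (Φ : PartialDiffeomorph 𝓘(ℝ, ℝ × ℝ) (𝓡 2) (ℝ × ℝ) M ∞) (α : ℝ → Mink 2)
          (T₀ : Mink 2) (ε : ℝ), 0 < ε ∧
            Φ.source = Set.Ioo (-ε) ε ×ˢ Set.Ioo (-ε) ε ∧ Φ (0, 0) = p ∧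
            IsNullCylinderParametrization f Φ α T₀) ∧
    -- conversely, the part of a surface that is parametrized in this way
    (∀ (Φ : PartialDiffeomorph 𝓘(ℝ, ℝ × ℝ) (𝓡 2) (ℝ × ℝ) M ∞) (α : ℝ → Mink 2) (T₀ : Mink 2),
      IsNullCylinderParametrization f Φ α T₀ →
        -- is timelike,
        IsTimelikeSurfaceOn f Φ.target ∧
        -- every spacelike vector orthogonal to `T₀` has a tangent part of the form `H(x) T₀`, and
        -- defines a canonical null direction as soon as it is nowhere orthogonal to `α'`,
        (∀ Z : Mink 2, IsSpacelike Z → mink Z T₀ = 0 →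
          (∃ H : ℝ → ℝ, ContDiffOn ℝ ∞ H (Prod.fst '' Φ.source) ∧
            ∀ q ∈ Φ.source, IsTangentPart f (Φ q) Z (H q.1 • T₀)) ∧
          (HasCanonicalNullDirectionOn f Φ.target Z ↔
            ∀ x ∈ Prod.fst '' Φ.source, mink Z (deriv α x) ≠ 0)) ∧
        -- and such vectors exist over every compact set of values of `x`
        (∀ K ⊆ Prod.fst '' Φ.source, IsCompact K →
          ∃ Z : Mink 2, IsSpacelike Z ∧ mink Z T₀ = 0 ∧
            HasCanonicalNullDirectionOn f (Φ '' {q ∈ Φ.source | q.1 ∈ K}) Z)) := by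
  refine ⟨fun hf Z hZ p ↦ hf.exists_isNullCylinderParametrization hZ p, fun Φ α T₀ h ↦
    ⟨h.isTimelikeSurfaceOn, fun Z _ hZ ↦ ⟨⟨_, h.contDiffOn_div Z, fun q hq ↦
      (h.isTangentPart_iff hq hZ _).2 rfl⟩, h.hasCanonicalNullDirectionOn_iff hZ⟩,
      fun K hK hKc ↦ h.exists_hasCanonicalNullDirectionOn hK hKc⟩⟩
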